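/- All graphs are finite and simple. For a graph $G$ let $k_t(G)$ denote the number of $t$-cliques of $G$, i.e. of $t$-element sets of pairwise adjacent vertices. $G$ is \emph{traceable} if it has a Hamiltonian path, \emph{Hamiltonian} if it has a Hamiltonian cycle (the one-vertex graph being counted as Hamiltonian by convention), and \emph{Hamiltonian-connected} if every two distinct vertices are joined by a Hamiltonian path. $G$ is \emph{$k$-path Hamiltonian} if every path of length at most $k$ in $G$ is contained in a Hamiltonian cycle of $G$, and \emph{$k$-Hamiltonian} if for every $0\le \ell\le k$ the removal of any $\ell$ vertices of $G$ results in a Hamiltonian graph. The colex order on finite subsets of $\mathbb N$ is defined by $A<_C B$ if and only if $A\ne B$ and $\max(A\bigtriangleup B)\in B$. The \emph{colex graph} $\mathcal C(m)$ is the graph whose edges are the first $m$ two-element subsets of $\mathbb N$ in colex order and whose vertex set is the union of these edges. Let $G$ be a graph on $n\ge 1$ vertices and let $t\ge 2$. \begin{enumerate} \item If $G$ is not traceable, then $k_t(G)\le k_t(K_{n-1})$. If $G$ is a $K_{n-1}$ plus an isolated vertex, then equality holds, and $G$ is not traceable if $n\ge 2$. \item If $G$ is not Hamiltonian, then $k_t(G)\le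 k_t\big(\mathcal C(\binom{n-1}{2}+1)\big)$. If $G\cong \mathcal C(\binom{n-1}{2}+1)$, then $G$ is not Hamiltonian and equality holds. For $n\ge 2$, $\mathcal C(\binom{n-1}{2}+1)$ has $n$ vertices and is a $K_{n-1}$ plus a vertex of degree $1$. \item Let $n\ge 4$. If $G$ is not Hamiltonian-connected, then $k_t(G)\le k_t\big(\mathcal C(\binom{n-1}{2}+2)\big)$. If $G\cong \mathcal C(\binom{n-1}{2}+2)$, then $G$ is not Hamiltonian-connected and equality holds. Moreover $\mathcal C(\binom{n-1}{2}+2)$ has $n$ vertices and is a $K_{n-1}$ plus a vertex of degree $2$. \item Let $0\le k\le n-3$. If $G$ is not $k$-path Hamiltonian, then $k_t(G)\le k_t\big(\mathcal C(\binom{n-1}{2}+k+1)\big)$. If $G\cong \mathcal C(\binom{n-1}{2}+k+1)$, then $G$ is not $k$-path Hamiltonian and equality holds. \item Let $0\le k\le n-3$. If $G$ is not $k$-Hamiltonian, then $k_t(G)\le k_t\big(\mathcal C(\binom{n-1}{2}+k+1)\big)$. If $G\cong \mathcal C(\binom{n-1}{2}+k+1)$, then $G$ is not $k$-Hamiltonian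 and equality holds. \end{enumerate} For $0\le k\le n-3$, the graph $\mathcal C(\binom{n-1}{2}+k+1)$ in parts 4 and 5 has $n$ vertices and is a $K_{n-1}$ plus a vertex of degree $k+1$. -/

import Mathlib

namespace SimpleGraph

/-- `G` contains a Hamiltonian path. -/
def IsTraceable {V : Type*} [DecidableEq V] (G : SimpleGraph V) : Prop :=
  ∃ (u v : V) (p : G.Walk u v), p.IsHamiltonian

/-- Every pair of distinct vertices of `G` is joined by a Hamiltonian path. -/
def IsHamiltonianConnected {V : Type*} [DecidableEq V] (G : SimpleGraph V) : Prop :=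
  ∀ u v : V, u ≠ v → ∃ p : G.Walk u v, p.IsHamiltonian

/-- Every path of `G` of length at most `k` is contained in a Hamiltonian cycle of `G`. -/
def IsPathHamiltonian {V : Type*} [DecidableEq V] (G : SimpleGraph V) (k : ℕ) : Prop :=
  ∀ (u v : V) (p : G.Walk u v), p.IsPath → p.length ≤ k →
    ∃ (a : V) (c : G.Walk a a), c.IsHamiltonianCycle ∧ p.toSubgraph ≤ c.toSubgraph

/-- The removal of any set of at most `k` vertices of `G` results in a Hamiltonian graph. -/
def IsKHamiltonian {V : Type*} [Fintype V] [DecidableEq V] (G : SimpleGraph V) (k : ℕ) : Prop :=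
  ∀ s : Finset V, s.card ≤ k → (G.induce (↑(sᶜ) : Set V)).IsHamiltonian

/-- The number of `t`-cliques of `G`. -/
noncomputable def numCliques {V : Type*} (G : SimpleGraph V) (t : ℕ) : ℕ :=
  (G.cliqueSet t).ncard

/-- `G` is a complete graph together with one more vertex, of degree `d`. -/
def IsCompletePlusVertex {V : Type*} (G : SimpleGraph V) (d : ℕ) : Prop :=
  ∃ v : V, (G.neighborSet v).encard = d ∧ ∀ x y : V, x ≠ v → y ≠ v → x ≠ y → G.Adj x y

/-- The first `m` two-element subsets of `ℕ` in the colexicographic order: those which have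
fewer than `m` predecessors. -/
def colexPairs (m : ℕ) : Set (Finset ℕ) :=
  {P | P.card = 2 ∧
    {Q : Finset ℕ | Q.card = 2 ∧ toColex Q < toColex P}.encard < m}

/-- The graph on all of `ℕ` whose edges are the first `m` pairs in the colexicographic order. -/
def colexGraphNat (m : ℕ) : SimpleGraph ℕ where
  Adj i j := i ≠ j ∧ {i, j} ∈ colexPairs m
  symm := ⟨fun i j h => ⟨h.1.symm, by rw [Finset.pair_comm]; exact h.2⟩⟩
  loopless := ⟨fun _ h => h.1 rfl⟩

/-- The colex graph on `m` edges; its vertices are the natural numbers that lie in some edge. -/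
def colexGraph (m : ℕ) : SimpleGraph (colexGraphNat m).support :=
  (colexGraphNat m).induce (colexGraphNat m).support

end SimpleGraph

/-
Suppose few edges are missing from `G`. Deleting a vertex of small degree in the complement keeps
that so, and the vertex can be inserted back into a path spanning the rest: otherwise it would miss
one of any two consecutive vertices of the path, hence about half of them. By induction, any set of
vertices with few missing edges is spanned by a path whose ends avoid a small set, and such paths
close up to the Hamiltonian paths and cycles required. A graph without the property therefore misses
many edges, and Kruskal–Katona turns the bound on its number of edges into a bound on its number of
cliques.

In a complete graph plus a vertex `w` of degree `k + 1`, a path through all neighbours of `w` lies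
in no Hamiltonian cycle: the edges of the cycle at `w` would have to lead to the ends of the path,
closing it up before the cycle has met the non-neighbours of `w`.
-/

namespace HamiltonianExtremal

open SimpleGraph Finset

section SparseComplement

variable {V : Type*}

/-- The number of edges of `H` with both ends in `s`; it is applied to the complement of the graph
under study. -/
def numEdgesOn (H : SimpleGraph V) [DecidableRel H.Adj] (s : Finset V) : ℕ :=
  #{e ∈ s.sym2 | e ∈ H.edgeSet}

theorem numEdgesOn_mono (H : SimpleGraph V) [DecidableRel H.Adj] {s t : Finset V} (hst : s ⊆ t) :
    numEdgesOn H s ≤ numEdgesOn H t :=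
  card_le_card (filter_subset_filter _ (sym2_mono hst))

theorem numEdgesOn_univ [Fintype V] (H : SimpleGraph V) [DecidableRel H.Adj] :
    numEdgesOn H univ = H.edgeSet.ncard := by
  rw [numEdgesOn, sym2_univ, Set.ncard_eq_toFinset_card', ← edgeFinset]
  congr 1
  ext e
  simp only [mem_filter_univ, mem_edgeFinset]

/- If `w` is not adjacent to two consecutive vertices of `p`, then every step of `p` meets a
non-neighbour of `w`, and counting these over all steps contradicts `h`. -/
theorem exists_walk_support_perm_cons {G : SimpleGraph V} [DecidableRel G.Adj] {a b : V}
    (p : G.Walk a b) (w : V)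
    (h : 2 * p.support.countP (¬ G.Adj w ·)
      < p.length + (if G.Adj w a then 0 else 1) + (if G.Adj w b then 0 else 1)) :
    ∃ q : G.Walk a b, q.support.Perm (w :: p.support) := by
  induction p with
  | nil =>
    simp only [Walk.support_nil, List.countP_singleton, Walk.length_nil] at h
    split_ifs at h <;> simp_all
  | @cons a x b hax p ih =>
    by_cases hins : G.Adj w a ∧ G.Adj w x
    · exact ⟨.cons hins.1.symm (.cons hins.2 p), List.Perm.swap w a p.support⟩
    · obtain ⟨q, hq⟩ := ih (by
        simp only [Walk.support_cons, List.countP_cons, Walk.length_cons] at h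
        split_ifs at h ⊢ <;> simp_all <;> omega)
      exact ⟨.cons hax q, (hq.cons a).trans (List.Perm.swap w a p.support)⟩

theorem exists_adj_of_numEdgesOn_pos {H : SimpleGraph V} [DecidableRel H.Adj] {s : Finset V}
    (h : 0 < numEdgesOn H s) : ∃ x ∈ s, ∃ y ∈ s, H.Adj x y := by
  obtain ⟨⟨x, y⟩, hxy⟩ := card_pos.1 h
  obtain ⟨hmem, hadj⟩ := mem_filter.1 hxy
  obtain ⟨hx, hy⟩ := mk_mem_sym2_iff.1 hmem
  exact ⟨x, hx, y, hy, hadj⟩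

theorem numEdgesOn_insert [DecidableEq V] (H : SimpleGraph V) [DecidableRel H.Adj]
    {s : Finset V} {v : V} (hv : v ∉ s) :
    numEdgesOn H (insert v s) = numEdgesOn H s + #{y ∈ s | H.Adj v y} := by
  have hstar : {e ∈ (insert v s).image (fun y => s(v, y)) | e ∈ H.edgeSet}
      = ({y ∈ s | H.Adj v y}).image (fun y => s(v, y)) := by
    rw [filter_image]
    simp only [mem_edgeSet, filter_insert, H.irrefl, if_false]
  have hinj : Function.Injective fun y => s(v, y) := fun _ _ => Sym2.congr_right.1
  have hdisj : Disjoint {e ∈ s.sym2 | e ∈ H.edgeSet}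
      (({y ∈ s | H.Adj v y}).image (fun y => s(v, y))) := by
    simp only [Finset.disjoint_left, mem_filter, mem_image, mem_sym2_iff]
    rintro e ⟨he, -⟩ ⟨y, -, rfl⟩
    exact hv (he v (Sym2.mem_mk_left v y))
  rw [numEdgesOn, sym2_insert, filter_union, hstar, union_comm, card_union_of_disjoint hdisj,
    card_image_of_injective _ hinj, numEdgesOn]

theorem numEdgesOn_erase_add [DecidableEq V] (H : SimpleGraph V) [DecidableRel H.Adj]
    {s : Finset V} {v : V} (hv : v ∈ s) :
    numEdgesOn H (s.erase v) + #{y ∈ s | H.Adj v y} = numEdgesOn H s := by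
  have hdeg : #{y ∈ s | H.Adj v y} = #{y ∈ s.erase v | H.Adj v y} := by
    conv_lhs => rw [← insert_erase hv, filter_insert, if_neg H.irrefl]
  conv_rhs => rw [← insert_erase hv, numEdgesOn_insert H (notMem_erase v s)]
  rw [hdeg]

theorem card_adj_add_card_adj_le (H : SimpleGraph V) [DecidableRel H.Adj] {s : Finset V} {x y : V}
    (hx : x ∈ s) (hy : y ∈ s) (hxy : H.Adj x y) :
    #{z ∈ s | H.Adj x z} + #{z ∈ s | H.Adj y z} ≤ numEdgesOn H s + 1 := by
  classical
  have hdeg : #{z ∈ s.erase x | H.Adj y z} + 1 = #{z ∈ s | H.Adj y z} := by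
    rw [filter_erase, card_erase_add_one (mem_filter.2 ⟨hx, hxy.symm⟩)]
  have := numEdgesOn_erase_add H hx
  have := numEdgesOn_erase_add H (mem_erase.2 ⟨hxy.ne', hy⟩)
  omega

theorem numEdgesOn_add_card_adj_or_adj_le [Finite V] (H : SimpleGraph V) [DecidableRel H.Adj]
    {s : Finset V} {a b : V} (ha : a ∉ s) (hb : b ∉ s) :
    numEdgesOn H s + #{z ∈ s | H.Adj a z ∨ H.Adj b z} ≤ H.edgeSet.ncard := by
  classical
  have := Fintype.ofFinite V
  rw [← numEdgesOn_univ]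
  rcases eq_or_ne a b with rfl | hab
  · simp only [or_self, ← numEdgesOn_insert H ha]
    exact numEdgesOn_mono H (subset_univ _)
  · calc numEdgesOn H s + #{z ∈ s | H.Adj a z ∨ H.Adj b z}
      _ ≤ numEdgesOn H s + #{z ∈ s | H.Adj b z} + #{z ∈ insert b s | H.Adj a z} := by
        rw [filter_or, add_assoc, add_comm #{z ∈ s | H.Adj b z}]
        gcongr
        refine (card_union_le _ _).trans ?_
        gcongr
        exact subset_insert b s
      _ = numEdgesOn H (insert a (insert b s)) := by
        rw [numEdgesOn_insert H (by simp [hab, ha]), numEdgesOn_insert H hb]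
      _ ≤ numEdgesOn H univ := numEdgesOn_mono H (subset_univ _)

variable [DecidableEq V]

theorem card_erase_inter_add_ite {R : Finset V} (S : Finset V) {w : V} (hw : w ∈ R) :
    #(R.erase w ∩ S) + (if w ∈ S then 1 else 0) = #(R ∩ S) := by
  rw [erase_inter]
  split_ifs with hwS
  · exact card_erase_add_one (mem_inter.2 ⟨hw, hwS⟩)
  · rw [erase_eq_of_notMem fun h => hwS (mem_inter.1 h).2, add_zero]

/-- `G` has a path with vertex set `R` whose two ends lie outside `S`. The set `S` of forbidden ends
lets the path be closed up through vertices outside `R`. -/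
def HasSpanningPath (G : SimpleGraph V) (R S : Finset V) : Prop :=
  ∃ u ∉ S, ∃ v ∉ S, ∃ p : G.Walk u v, p.IsPath ∧ ∀ x, x ∈ p.support ↔ x ∈ R

variable {G : SimpleGraph V} [DecidableRel G.Adj]

theorem HasSpanningPath.insert {R S : Finset V} (hR : HasSpanningPath G R S) {w : V} (hw : w ∉ R)
    (h : 2 * (#{y ∈ R | Gᶜ.Adj w y} + if w ∈ S then 1 else 0) ≤ #R) :
    HasSpanningPath G (insert w R) S := by
  obtain ⟨u, hu, v, hv, p, hp, hsupp⟩ := hR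
  have hsuppR : p.support.toFinset = R := by ext x; rw [List.mem_toFinset, hsupp]
  have hlen : #R = p.length + 1 := by
    rw [← hsuppR, List.toFinset_card_of_nodup hp.support_nodup, Walk.length_support]
  have hwp : w ∉ p.support := (hsupp w).not.2 hw
  have hcount : p.support.countP (¬ G.Adj w ·) = #{y ∈ R | Gᶜ.Adj w y} := by
    rw [List.countP_eq_length_filter, ← List.toFinset_card_of_nodup (hp.support_nodup.filter _)]
    congr 1
    ext y
    have hne : y ∈ R → w ≠ y := fun hy => (ne_of_mem_of_not_mem hy hw).symm
    simp only [List.mem_toFinset, List.mem_filter, hsupp, mem_filter, compl_adj, decide_eq_true_eq]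
    tauto
  have hinterior : (∃ q : G.Walk u v, q.support.Perm (w :: p.support)) →
      HasSpanningPath G (Insert.insert w R) S := by
    rintro ⟨q, hq⟩
    refine ⟨u, hu, v, hv, q, ?_, fun x => ?_⟩
    · rw [Walk.isPath_def, hq.nodup_iff]
      exact hp.support_nodup.cons hwp
    · rw [hq.mem_iff, List.mem_cons, hsupp, mem_insert]
  by_cases hwS : w ∈ S
  · exact hinterior (exists_walk_support_perm_cons p w (by simp only [hwS, if_true] at h; omega))
  by_cases hwu : G.Adj w u
  · exact ⟨w, hwS, v, hv, .cons hwu p, hp.cons hwp, fun x => by simp [hsupp]⟩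
  by_cases hwv : G.Adj w v
  · exact ⟨u, hu, w, hwS, p.concat hwv.symm, hp.concat hwp hwv.symm, fun x => by
      simp [Walk.support_concat, hsupp, or_comm]⟩
  · refine hinterior (exists_walk_support_perm_cons p w ?_)
    simp only [hwS, hwu, hwv, if_false] at h ⊢
    omega

theorem exists_light_vertex {R S : Finset V} (hR : 3 ≤ #R)
    (h : numEdgesOn Gᶜ R + #(R ∩ S) + 2 ≤ #R) :
    ∃ w ∈ R, 2 * (#{y ∈ R | Gᶜ.Adj w y} + if w ∈ S then 1 else 0) < #R ∧
      numEdgesOn Gᶜ (R.erase w) + #(R.erase w ∩ S) + 3 ≤ #R := by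
  have hinter {w : V} (hw : w ∈ R) := card_erase_inter_add_ite S hw
  have hedges {w : V} (hw : w ∈ R) := numEdgesOn_erase_add Gᶜ hw
  rcases Nat.eq_zero_or_pos (numEdgesOn Gᶜ R) with hzero | hpos
  · obtain ⟨w, hw, hwS⟩ : ∃ w ∈ R, w ∈ S ∨ #(R ∩ S) = 0 := by
      rcases (R ∩ S).eq_empty_or_nonempty with hempty | ⟨w, hw⟩
      · obtain ⟨w, hw⟩ := card_pos.1 (by omega : 0 < #R)
        exact ⟨w, hw, .inr (card_eq_zero.2 hempty)⟩
      · exact ⟨w, (mem_inter.1 hw).1, .inl (mem_inter.1 hw).2⟩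
    have := hinter hw
    have := hedges hw
    refine ⟨w, hw, ?_, ?_⟩ <;> split_ifs at * <;> grind
  · obtain ⟨x, hx, y, hy, hxy⟩ := exists_adj_of_numEdgesOn_pos hpos
    have hdeg {a b : V} (hb : b ∈ R) (hab : Gᶜ.Adj a b) : 0 < #{z ∈ R | Gᶜ.Adj a z} :=
      card_pos.2 ⟨b, mem_filter.2 ⟨hb, hab⟩⟩
    have hS : (if x ∈ S then 1 else 0) + (if y ∈ S then 1 else 0) ≤ #(R ∩ S) := by
      rw [← hinter hx, add_comm]
      gcongr
      split_ifs with hyS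
      exacts [card_pos.2 ⟨y, mem_inter.2 ⟨mem_erase.2 ⟨hxy.ne', hy⟩, hyS⟩⟩, Nat.zero_le _]
    have := card_adj_add_card_adj_le Gᶜ hx hy hxy
    rcases le_total (#{z ∈ R | Gᶜ.Adj x z} + if x ∈ S then 1 else 0)
      (#{z ∈ R | Gᶜ.Adj y z} + if y ∈ S then 1 else 0) with hle | hle
    · have := hedges hx
      have := hdeg hy hxy
      have := hinter hx
      exact ⟨x, hx, by omega, by omega⟩
    · have := hedges hy
      have := hdeg hx hxy.symm
      have := hinter hy
      exact ⟨y, hy, by omega, by omega⟩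

theorem hasSpanningPath_of_numEdgesOn_compl {R S : Finset V}
    (h : numEdgesOn Gᶜ R + #(R ∩ S) + 2 ≤ #R) : HasSpanningPath G R S := by
  induction hr : #R using Nat.strong_induction_on generalizing R with | _ r ih
  rcases (by omega : #R = 2 ∨ 3 ≤ #R) with htwo | hthree
  · obtain ⟨u, v, huv, rfl⟩ := card_eq_two.1 htwo
    have hS : {u, v} ∩ S = ∅ := card_eq_zero.1 (by omega)
    have hadj : G.Adj u v := by
      by_contra hnadj
      have : 0 < numEdgesOn Gᶜ {u, v} := card_pos.2
        ⟨s(u, v), mem_filter.2 ⟨by simp, by simp [huv, hnadj]⟩⟩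
      omega
    have hnotMem {x : V} (hx : x ∈ ({u, v} : Finset V)) : x ∉ S := fun hxS => by
      simpa [hS] using mem_inter.2 ⟨hx, hxS⟩
    exact ⟨u, hnotMem (by simp), v, hnotMem (by simp), hadj.toWalk, by simp [huv], by simp⟩
  · obtain ⟨w, hw, hlight, hsparse⟩ := exists_light_vertex hthree h
    have hcard := card_erase_add_one hw
    have hdeg : #{y ∈ R.erase w | Gᶜ.Adj w y} = #{y ∈ R | Gᶜ.Adj w y} := by
      rw [filter_erase, erase_eq_of_notMem (by simp)]
    rw [← insert_erase hw]
    refine (ih _ (by omega) (by omega) rfl).insert (notMem_erase w R) ?_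
    omega

end SparseComplement

section Hamiltonicity

variable {V : Type*} [Fintype V]

theorem ncard_edgeSet_le_of_card_le {j : ℕ} (G : SimpleGraph V)
    (h : Fintype.card V ≤ Gᶜ.edgeSet.ncard + j + 1) :
    G.edgeSet.ncard ≤ (Fintype.card V - 1).choose 2 + j := by
  classical
  have hsum : G.edgeSet.ncard + Gᶜ.edgeSet.ncard = (Fintype.card V).choose 2 := by
    rw [← Set.ncard_union_eq (disjoint_edgeSet.2 disjoint_compl_right), ← edgeSet_sup,
      sup_compl_eq_top, ← coe_edgeFinset, Set.ncard_coe_finset,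
      card_edgeFinset_top_eq_card_choose_two]
  rcases hn : Fintype.card V with _ | n
  · rw [hn, Nat.choose_zero_succ] at hsum
    omega
  · have hpascal : (n + 1).choose 2 = n + n.choose 2 := by
      rw [Nat.choose_succ_succ' n 1, Nat.choose_one_right]
    rw [Nat.add_sub_cancel]
    rw [hn] at hsum
    omega

variable [DecidableEq V] {G : SimpleGraph V}

theorem exists_isPath_between_neighbors {T : Finset V} {a b : V} (ha : a ∈ T)
    (hb : b ∈ T) (h : Gᶜ.edgeSet.ncard + 2 ≤ #Tᶜ) :
    ∃ (x y : V) (q : G.Walk x y), G.Adj a x ∧ G.Adj b y ∧ q.IsPath ∧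
      ∀ z, z ∈ q.support ↔ z ∉ T := by
  classical
  set S : Finset V := {z | Gᶜ.Adj a z ∨ Gᶜ.Adj b z} with hS
  have hedges := numEdgesOn_add_card_adj_or_adj_le Gᶜ (s := Tᶜ) (a := a) (b := b)
    (by simpa) (by simpa)
  have hinter : Tᶜ ∩ S = {z ∈ Tᶜ | Gᶜ.Adj a z ∨ Gᶜ.Adj b z} := by
    rw [hS, inter_filter, inter_univ]
  obtain ⟨x, hx, y, hy, q, hq, hsupp⟩ :=
    hasSpanningPath_of_numEdgesOn_compl (G := G) (R := Tᶜ) (S := S) (by rw [hinter]; omega)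
  simp only [mem_compl] at hsupp
  have hadj {c z : V} (hc : c ∈ T) (hz : z ∈ q.support) (hcz : ¬ Gᶜ.Adj c z) : G.Adj c z := by
    have hne : c ≠ z := fun h => (hsupp z).1 hz (h ▸ hc)
    simpa [hne] using hcz
  simp only [hS, mem_filter_univ, not_or] at hx hy
  exact ⟨x, y, q, hadj ha q.start_mem_support hx.1, hadj hb q.end_mem_support hy.2, hq, hsupp⟩

theorem isTraceable_of_ncard_edgeSet_compl (h : Gᶜ.edgeSet.ncard + 2 ≤ Fintype.card V) :
    G.IsTraceable := by
  classical
  obtain ⟨u, -, v, -, p, hp, hsupp⟩ :=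
    hasSpanningPath_of_numEdgesOn_compl (G := G) (R := univ) (S := ∅) (by
      rwa [numEdgesOn_univ, inter_empty, card_empty, add_zero, card_univ])
  exact ⟨u, v, p, hp.isHamiltonian_of_mem fun x => (hsupp x).2 (mem_univ x)⟩

theorem isHamiltonianConnected_of_ncard_edgeSet_compl
    (h : Gᶜ.edgeSet.ncard + 4 ≤ Fintype.card V) : G.IsHamiltonianConnected := by
  classical
  intro u v huv
  obtain ⟨x, y, q, hux, hvy, hq, hsupp⟩ :=
    exists_isPath_between_neighbors (G := G) (T := {u, v}) (a := u) (b := v) (by simp) (by simp) (by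
      rw [card_compl, card_pair huv]
      omega)
  have hu : u ∉ q.support := by simp [hsupp]
  have hv : v ∉ q.support := by simp [hsupp]
  have hpath : (Walk.cons hux (q.concat hvy.symm)).IsPath :=
    (hq.concat hv hvy.symm).cons (by simp [Walk.support_concat, hu, huv])
  refine ⟨_, hpath.isHamiltonian_of_mem fun z => ?_⟩
  simp only [Walk.support_cons, Walk.support_concat, List.mem_cons, List.mem_append,
    List.not_mem_nil, hsupp, mem_insert, mem_singleton]
  tauto

theorem exists_isHamiltonianCycle_of_isPath {u v : V} {p : G.Walk u v} (hp : p.IsPath)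
    (h : Gᶜ.edgeSet.ncard + p.length + 3 ≤ Fintype.card V) :
    ∃ c : G.Walk u u, c.IsHamiltonianCycle ∧ p.toSubgraph ≤ c.toSubgraph := by
  classical
  have hcard : #p.support.toFinset = p.length + 1 := by
    rw [List.toFinset_card_of_nodup hp.support_nodup, Walk.length_support]
  obtain ⟨x, y, q, hvx, huy, hq, hsupp⟩ :=
    exists_isPath_between_neighbors (G := G) (T := p.support.toFinset) (a := v) (b := u)
      (by simp) (by simp) (by rw [card_compl]; omega)
  simp only [List.mem_toFinset] at hsupp
  have hqlen : q.length + 1 + (p.length + 1) = Fintype.card V := by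
    have hcompl : q.support.toFinset = p.support.toFinsetᶜ := by
      ext z
      simp [hsupp]
    rw [← hcard, ← Walk.length_support, ← List.toFinset_card_of_nodup hq.support_nodup, hcompl,
      card_compl_add_card]
  have hx : x ∉ p.support := (hsupp x).1 q.start_mem_support
  have hu : u ∉ q.support := fun h => (hsupp u).1 h p.start_mem_support
  have hdisj : (p.concat hvx).support.tail.Disjoint (q.concat huy.symm).support.tail := by
    have hu' : u ∉ p.support.tail := (List.nodup_cons.1 (p.cons_tail_support ▸ hp.support_nodup)).1
    have hx' : x ∉ q.support.tail := (List.nodup_cons.1 (q.cons_tail_support ▸ hq.support_nodup)).1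
    have hpq : p.support.tail.Disjoint q.support.tail := fun z hzp hzq =>
      (hsupp z).1 (List.mem_of_mem_tail hzq) (List.mem_of_mem_tail hzp)
    have hux : u ≠ x := fun h => hu (h ▸ q.start_mem_support)
    simp only [Walk.support_concat, List.tail_append_of_ne_nil (Walk.support_ne_nil _)]
    simp [hu', hx', hpq, hux]
  have hcycle : ((p.concat hvx).append (q.concat huy.symm)).IsCycle :=
    (hp.concat hx hvx).isCycle_append (hq.concat hu huy.symm) hdisj
      (.inr (by rw [Walk.length_concat]; omega))
  refine ⟨_, Walk.isHamiltonianCycle_iff_isCycle_and_length_eq.2 ⟨hcycle, ?_⟩, ?_⟩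
  · simp only [Walk.length_append, Walk.length_concat]
    omega
  · rw [Walk.toSubgraph_append, Walk.concat_eq_append, Walk.toSubgraph_append, sup_assoc]
    exact le_sup_left

theorem isPathHamiltonian_of_ncard_edgeSet_compl {k : ℕ}
    (h : Gᶜ.edgeSet.ncard + k + 3 ≤ Fintype.card V) : G.IsPathHamiltonian k :=
  fun u _ _ hp hk => ⟨u, exists_isHamiltonianCycle_of_isPath hp (by omega)⟩

theorem isHamiltonian_of_ncard_edgeSet_compl (h : Gᶜ.edgeSet.ncard + 3 ≤ Fintype.card V) :
    G.IsHamiltonian := by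
  obtain ⟨u⟩ : Nonempty V := Fintype.card_pos_iff.1 (by omega)
  obtain ⟨c, hc, -⟩ := exists_isHamiltonianCycle_of_isPath (.nil : (Walk.nil : G.Walk u u).IsPath) h
  exact fun _ => ⟨u, c, hc⟩

theorem isKHamiltonian_of_ncard_edgeSet_compl {k : ℕ}
    (h : Gᶜ.edgeSet.ncard + k + 3 ≤ Fintype.card V) : G.IsKHamiltonian k := by
  intro s hs
  refine isHamiltonian_of_ncard_edgeSet_compl ?_
  have hedges : (G.induce (↑(sᶜ) : Set V))ᶜ.edgeSet.ncard ≤ Gᶜ.edgeSet.ncard := by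
    let f := Embedding.complEquiv (Embedding.induce (G := G) (↑(sᶜ) : Set V))
    exact Nat.card_le_card_of_injective _ f.mapEdgeSet.injective
  have hcard : Fintype.card (↑(sᶜ) : Set V) = Fintype.card V - #s := by
    rw [← card_compl]
    exact Fintype.card_of_finset' _ fun _ => mem_coe.symm
  omega

theorem ncard_edgeSet_le_of_not_isTraceable (hG : ¬ G.IsTraceable) :
    G.edgeSet.ncard ≤ (Fintype.card V - 1).choose 2 :=
  ncard_edgeSet_le_of_card_le (j := 0) G <| by
    by_contra!
    exact hG (isTraceable_of_ncard_edgeSet_compl (by omega))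

theorem ncard_edgeSet_le_of_not_isHamiltonian (hG : ¬ G.IsHamiltonian) :
    G.edgeSet.ncard ≤ (Fintype.card V - 1).choose 2 + 1 :=
  ncard_edgeSet_le_of_card_le G <| by
    by_contra!
    exact hG (isHamiltonian_of_ncard_edgeSet_compl (by omega))

theorem ncard_edgeSet_le_of_not_isHamiltonianConnected (hG : ¬ G.IsHamiltonianConnected) :
    G.edgeSet.ncard ≤ (Fintype.card V - 1).choose 2 + 2 :=
  ncard_edgeSet_le_of_card_le G <| by
    by_contra!
    exact hG (isHamiltonianConnected_of_ncard_edgeSet_compl (by omega))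

theorem ncard_edgeSet_le_of_not_isPathHamiltonian {k : ℕ} (hG : ¬ G.IsPathHamiltonian k) :
    G.edgeSet.ncard ≤ (Fintype.card V - 1).choose 2 + k + 1 :=
  ncard_edgeSet_le_of_card_le (j := k + 1) G <| by
    by_contra!
    exact hG (isPathHamiltonian_of_ncard_edgeSet_compl (by omega))

theorem ncard_edgeSet_le_of_not_isKHamiltonian {k : ℕ} (hG : ¬ G.IsKHamiltonian k) :
    G.edgeSet.ncard ≤ (Fintype.card V - 1).choose 2 + k + 1 :=
  ncard_edgeSet_le_of_card_le (j := k + 1) G <| by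
    by_contra!
    exact hG (isKHamiltonian_of_ncard_edgeSet_compl (by omega))

end Hamiltonicity

section NumCliques

variable {V W : Type*} {G : SimpleGraph V} {H : SimpleGraph W}

theorem numCliques_eq_of_embedding (f : G ↪g H) (hf : H.support ⊆ Set.range f) {t : ℕ}
    (ht : t ≠ 1) : G.numCliques t = H.numCliques t := by
  have hmap : G.map f.toEmbedding = H := by
    ext x y
    refine ⟨?_, fun h => ?_⟩
    · rintro ⟨-, a, b, hab, rfl, rfl⟩
      exact f.map_adj_iff.2 hab
    · obtain ⟨⟨a, rfl⟩, b, rfl⟩ := And.intro (hf ⟨y, h⟩) (hf ⟨x, h.symm⟩)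
      exact ⟨h.ne, a, b, f.map_adj_iff.1 h, rfl, rfl⟩
  rw [numCliques, numCliques, ← hmap, cliqueSet_map ht,
    Set.ncard_image_of_injective _ (Finset.map_injective _)]

theorem numCliques_congr (f : G ≃g H) {t : ℕ} (ht : t ≠ 1) : G.numCliques t = H.numCliques t :=
  numCliques_eq_of_embedding f.toEmbedding (fun x _ => f.surjective x) ht

theorem mem_support_of_mem_clique {t : ℕ} (ht : 2 ≤ t) {s : Finset V} (hs : s ∈ G.cliqueSet t)
    {x : V} (hx : x ∈ s) : x ∈ G.support := by
  obtain ⟨y, hy, hyx⟩ := exists_mem_ne (by rw [hs.2]; omega) x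
  exact ⟨y, hs.1 hx hy hyx.symm⟩

end NumCliques

section Colex

theorem exists_lt_eq_pair_of_card_eq_two {α : Type*} [LinearOrder α] {s : Finset α}
    (hs : #s = 2) : ∃ a b, a < b ∧ s = {a, b} := by
  obtain ⟨a, b, hab, rfl⟩ := card_eq_two.1 hs
  rcases hab.lt_or_gt with hlt | hlt
  · exact ⟨a, b, hlt, rfl⟩
  · exact ⟨b, a, hlt, pair_comm a b⟩

theorem toColex_pair_lt_iff {α : Type*} [LinearOrder α] {a b i j : α} (hab : a < b) (hij : i < j) :
    toColex ({a, b} : Finset α) < toColex {i, j} ↔ b < j ∨ b = j ∧ a < i := by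
  rw [Finset.Colex.toColex_lt_toColex_iff_exists_forall_lt]
  simp only [mem_insert, mem_singleton]
  constructor
  · rintro ⟨x, hx, hxab, hlt⟩
    have := hlt a (.inl rfl)
    have := hlt b (.inr rfl)
    grind
  · rintro (hbj | ⟨rfl, hai⟩)
    · exact ⟨j, .inr rfl, by grind, by grind⟩
    · exact ⟨i, .inl rfl, by grind, by grind⟩

theorem setOf_toColex_lt_pair {i j : ℕ} (hij : i < j) :
    {Q : Finset ℕ | #Q = 2 ∧ toColex Q < toColex {i, j}}
      = ↑(powersetCard 2 (range j) ∪ (range i).image fun a => {a, j}) := by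
  ext Q
  simp only [Set.mem_ofPred_eq, coe_union, Set.mem_union, mem_coe, mem_powersetCard, mem_image,
    mem_range]
  constructor
  · rintro ⟨hQ, hlt⟩
    obtain ⟨a, b, hab, rfl⟩ := exists_lt_eq_pair_of_card_eq_two hQ
    rcases (toColex_pair_lt_iff hab hij).1 hlt with hbj | ⟨rfl, hai⟩
    · exact .inl ⟨by grind, hQ⟩
    · exact .inr ⟨a, hai, rfl⟩
  · rintro (⟨hsub, hQ⟩ | ⟨a, hai, rfl⟩)
    · obtain ⟨a, b, hab, rfl⟩ := exists_lt_eq_pair_of_card_eq_two hQ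
      exact ⟨hQ, (toColex_pair_lt_iff hab hij).2 (.inl (mem_range.1 (hsub (by simp))))⟩
    · have haj := hai.trans hij
      exact ⟨card_pair haj.ne, (toColex_pair_lt_iff haj hij).2 (.inr ⟨rfl, hai⟩)⟩

theorem encard_setOf_toColex_lt_pair {i j : ℕ} (hij : i < j) :
    {Q : Finset ℕ | #Q = 2 ∧ toColex Q < toColex {i, j}}.encard = (j.choose 2 + i : ℕ) := by
  have hinj : Set.InjOn (fun a => ({a, j} : Finset ℕ)) (range i) := by
    intro a _ b _ hab
    have hmem : a ∈ ({b, j} : Finset ℕ) := by simp [← show ({a, j} : Finset ℕ) = {b, j} from hab]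
    grind
  have hdisj : Disjoint (powersetCard 2 (range j)) ((range i).image fun a => {a, j}) := by
    simp only [Finset.disjoint_left, mem_powersetCard, mem_image]
    rintro Q ⟨hsub, -⟩ ⟨a, -, rfl⟩
    simpa using hsub (mem_insert_of_mem (mem_singleton_self j))
  rw [setOf_toColex_lt_pair hij, Set.encard_coe_eq_coe_finsetCard, card_union_of_disjoint hdisj,
    card_powersetCard, card_range, card_image_of_injOn hinj, card_range]

theorem colexGraphNat_adj_iff_of_lt {m i j : ℕ} (hij : i < j) :
    (colexGraphNat m).Adj i j ↔ j.choose 2 + i < m := by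
  change i ≠ j ∧ #{i, j} = 2 ∧ _ ↔ _
  rw [encard_setOf_toColex_lt_pair hij, Nat.cast_lt, card_pair hij.ne]
  simp only [ne_eq, hij.ne, not_false_eq_true, true_and]

theorem choose_two_add_lt_iff {N d i j : ℕ} (hd : d ≤ N) (hij : i < j) :
    j.choose 2 + i < N.choose 2 + d ↔ j < N ∨ j = N ∧ i < d := by
  have hsucc (k : ℕ) : (k + 1).choose 2 = k.choose 2 + k := by
    rw [Nat.choose_succ_succ' k 1, Nat.choose_one_right, add_comm]
  rcases lt_trichotomy j N with hlt | rfl | hlt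
  · have := hsucc j
    have := Nat.choose_le_choose 2 (Nat.succ_le_of_lt hlt)
    grind
  · simp
  · have := hsucc N
    have := Nat.choose_le_choose 2 (Nat.succ_le_of_lt hlt)
    grind

theorem colexGraphNat_adj_iff {N d i j : ℕ} (hd : d ≤ N) :
    (colexGraphNat (N.choose 2 + d)).Adj i j ↔
      i ≠ j ∧ (i < N ∧ j < N ∨ j = N ∧ i < d ∨ i = N ∧ j < d) := by
  rcases lt_trichotomy i j with h | rfl | h
  · rw [colexGraphNat_adj_iff_of_lt h, choose_two_add_lt_iff hd h]
    omega
  · simp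
  · rw [adj_comm, colexGraphNat_adj_iff_of_lt h, choose_two_add_lt_iff hd h]
    omega

theorem support_colexGraphNat {n d : ℕ} (hd : 1 ≤ d) (hdn : d + 1 ≤ n) :
    (colexGraphNat ((n - 1).choose 2 + d)).support = Set.Iio n := by
  ext i
  simp only [mem_support, colexGraphNat_adj_iff (show d ≤ n - 1 by omega), Set.mem_Iio]
  constructor
  · rintro ⟨j, h⟩
    omega
  · intro hi
    rcases Nat.eq_zero_or_pos i with rfl | hpos
    · exact ⟨n - 1, by omega⟩
    · exact ⟨0, by omega⟩

theorem encard_support_colexGraphNat {n d : ℕ} (hd : 1 ≤ d) (hdn : d + 1 ≤ n) :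
    (colexGraphNat ((n - 1).choose 2 + d)).support.encard = n := by
  rw [support_colexGraphNat hd hdn, ← coe_range, Set.encard_coe_eq_coe_finsetCard, card_range]

theorem nontrivial_support_colexGraphNat {m : ℕ} (hm : 1 ≤ m) :
    Nontrivial (colexGraphNat m).support := by
  have hadj : (colexGraphNat m).Adj 0 1 := (colexGraphNat_adj_iff_of_lt one_pos).2 (by simpa)
  exact ⟨⟨0, 1, hadj⟩, ⟨1, 0, hadj.symm⟩, fun h => zero_ne_one (congrArg Subtype.val h)⟩

theorem one_lt_card_of_iso_colexGraph {V : Type*} [Fintype V] {G : SimpleGraph V} {m : ℕ}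
    (hm : 1 ≤ m) (f : G ≃g colexGraph m) : 1 < Fintype.card V := by
  have := nontrivial_support_colexGraphNat hm
  exact Fintype.one_lt_card_iff_nontrivial.2 f.nontrivial

theorem finite_support_colexGraphNat (m : ℕ) : (colexGraphNat m).support.Finite := by
  refine (Set.finite_lt_nat (m + 2)).subset ?_
  intro x hx
  obtain ⟨y, hxy⟩ := (mem_support _).1 hx
  have hlt {i j : ℕ} (hij : i < j) (h : (colexGraphNat m).Adj i j) : j < m + 2 := by
    rw [colexGraphNat_adj_iff_of_lt hij] at h
    rcases j with _ | j
    · omega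
    · rw [Nat.choose_succ_succ' j 1, Nat.choose_one_right] at h
      omega
  rcases hxy.ne.lt_or_gt with h | h
  · exact h.trans (hlt h hxy)
  · exact hlt h hxy.symm

theorem isCompletePlusVertex_colexGraph {n d : ℕ} (hd : 1 ≤ d) (hdn : d + 1 ≤ n) :
    (colexGraph ((n - 1).choose 2 + d)).IsCompletePlusVertex d := by
  have hsupp (i : ℕ) : i ∈ (colexGraphNat ((n - 1).choose 2 + d)).support ↔ i < n := by
    rw [support_colexGraphNat hd hdn, Set.mem_Iio]
  have hadj (x y : (colexGraphNat ((n - 1).choose 2 + d)).support) :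
      (colexGraph _).Adj x y ↔ _ :=
    colexGraphNat_adj_iff (i := x) (j := y) (show d ≤ n - 1 by omega)
  refine ⟨⟨n - 1, (hsupp _).2 (by omega)⟩, ?_, fun x y hx hy hxy => ?_⟩
  · have hnbhd : Subtype.val '' (colexGraph ((n - 1).choose 2 + d)).neighborSet
        ⟨n - 1, (hsupp _).2 (by omega)⟩ = ↑(range d) := by
      ext i
      simp only [Set.mem_image, mem_neighborSet, hadj, Subtype.exists, hsupp, coe_range,
        Set.mem_Iio, exists_and_right, exists_eq_right, exists_prop, true_and]
      omega
    rw [← Subtype.val_injective.encard_image, hnbhd, Set.encard_coe_eq_coe_finsetCard, card_range]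
  · have := (hsupp x).1 x.2
    have := (hsupp y).1 y.2
    rw [ne_eq, Subtype.ext_iff] at hx hy hxy
    rw [hadj]
    dsimp only at hx hy
    omega

theorem numCliques_colexGraph (m : ℕ) {t : ℕ} (ht : t ≠ 1) :
    (colexGraph m).numCliques t = (colexGraphNat m).numCliques t :=
  numCliques_eq_of_embedding (Embedding.induce _) (fun x hx => ⟨⟨x, hx⟩, rfl⟩) ht

theorem numCliques_colexGraphNat_choose_two (N : ℕ) {t : ℕ} (ht : t ≠ 1) :
    (colexGraphNat (N.choose 2)).numCliques t = (⊤ : SimpleGraph (Fin N)).numCliques t := by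
  have hadj (i j : ℕ) : (colexGraphNat (N.choose 2)).Adj i j ↔ i ≠ j ∧ i < N ∧ j < N := by
    simpa using colexGraphNat_adj_iff (Nat.zero_le N)
  let f : (⊤ : SimpleGraph (Fin N)) ↪g colexGraphNat (N.choose 2) :=
    ⟨Fin.valEmbedding, by simp [hadj, Fin.ext_iff]⟩
  refine (numCliques_eq_of_embedding f ?_ ht).symm
  rintro x ⟨y, hxy⟩
  exact ⟨⟨x, ((hadj x y).1 hxy).2.1⟩, rfl⟩

end Colex

section KruskalKatona

open Finset.Colex

open scoped FinsetFamily

theorem exists_isInitSeg_card_eq {α : Type*} [Fintype α] [LinearOrder α] (r : ℕ) {c : ℕ}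
    (hc : c ≤ (Fintype.card α).choose r) :
    ∃ 𝒞 : Finset (Finset α), IsInitSeg 𝒞 r ∧ #𝒞 = c := by
  induction c with
  | zero => exact ⟨∅, isInitSeg_empty, card_empty⟩
  | succ c ih =>
    obtain ⟨𝒞, h𝒞, hcard⟩ := ih (by omega)
    obtain ⟨s, hs, hmin⟩ : ∃ s ∈ powersetCard r univ \ 𝒞, ∀ t ∈ powersetCard r univ \ 𝒞,
        toColex s ≤ toColex t := by
      refine exists_min_image _ toColex (sdiff_nonempty.2 fun hsub => ?_)
      have := card_le_card hsub
      rw [card_powersetCard, card_univ] at this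
      omega
    simp only [mem_sdiff, mem_powersetCard_univ] at hs hmin
    refine ⟨insert s 𝒞, ⟨?_, ?_⟩, by rw [card_insert_of_notMem hs.2, hcard]⟩
    · intro t ht
      rcases mem_insert.1 ht with rfl | ht
      exacts [hs.1, h𝒞.1 ht]
    · rintro u v hu ⟨hlt, hv⟩
      rw [mem_insert]
      rcases mem_insert.1 hu with rfl | hu
      · exact .inr (of_not_not fun h => (hmin v ⟨hv, h⟩).not_gt hlt)
      · exact .inr (h𝒞.2 hu ⟨hlt, hv⟩)

theorem isInitSeg_shadow_iterate {α : Type*} [Finite α] [LinearOrder α]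
    {𝒜 : Finset (Finset α)} {r : ℕ} (h : IsInitSeg 𝒜 r) (k : ℕ) :
    IsInitSeg (∂^[k] 𝒜) (r - k) := by
  induction k with
  | zero => simpa
  | succ k ih =>
    rw [Function.iterate_succ_apply', ← Nat.sub_sub]
    exact ih.shadow

theorem map_mem_colexPairs_of_isInitSeg {n m : ℕ} {𝒬 : Finset (Finset (Fin n))}
    (h : IsInitSeg 𝒬 2) (hm : #𝒬 ≤ m) {P : Finset (Fin n)} (hP : P ∈ 𝒬) :
    P.map Fin.valEmbedding ∈ colexPairs m := by
  refine ⟨by rw [card_map]; exact h.1 hP, ?_⟩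
  have hsub : {Q : Finset ℕ | #Q = 2 ∧ toColex Q < toColex (P.map Fin.valEmbedding)} ⊆
      ↑((𝒬.erase P).map (mapEmbedding Fin.valEmbedding).toEmbedding) := by
    rintro Q ⟨hQ, hlt⟩
    have hQn : ∀ b ∈ Q, b < n := forall_lt_mono hlt.le (by simp)
    obtain ⟨R, rfl⟩ : ∃ R : Finset (Fin n), R.map Fin.valEmbedding = Q :=
      ⟨attachFin Q hQn, map_valEmbedding_attachFin hQn⟩
    rw [card_map] at hQ
    rw [map_eq_image, map_eq_image] at hlt
    have hRP := (toColex_image_lt_toColex_image Fin.val_strictMono).1 hlt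
    refine mem_map_of_mem _ (mem_erase.2 ⟨?_, h.2 hP ⟨hRP, hQ⟩⟩)
    rintro rfl
    exact hRP.false
  refine (Set.encard_le_encard hsub).trans_lt ?_
  rw [Set.encard_coe_eq_coe_finsetCard, Nat.cast_lt, card_map]
  exact (card_erase_lt_of_mem hP).trans_le hm

theorem shadow_iterate_cliqueFinset_subset {V : Type*} [Fintype V] [DecidableEq V]
    (G : SimpleGraph V) [DecidableRel G.Adj] (r k : ℕ) :
    ∂^[k] (G.cliqueFinset (r + k)) ⊆ G.cliqueFinset r := by
  intro s hs
  obtain ⟨c, hc, hsc, hcard⟩ := mem_shadow_iterate_iff_exists_mem_card_add.1 hs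
  rw [mem_cliqueFinset_iff] at hc ⊢
  exact ⟨hc.1.subset (coe_subset.2 hsc), by have := hc.2; omega⟩

theorem card_cliqueFinset_two_le {V : Type*} [Fintype V] [DecidableEq V] (G : SimpleGraph V)
    [DecidableRel G.Adj] : #(G.cliqueFinset 2) ≤ G.edgeSet.ncard := by
  rw [← coe_edgeFinset, Set.ncard_coe_finset]
  refine (card_le_card fun s hs => ?_).trans (card_image_le (f := Sym2.toFinset))
  rw [mem_cliqueFinset_iff] at hs
  obtain ⟨a, b, hab, rfl⟩ := card_eq_two.1 hs.2
  exact mem_image.2 ⟨s(a, b), by simpa using hs.1 (by simp) (by simp) hab, Sym2.toFinset_mk_eq⟩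

theorem map_mem_cliqueSet_colexGraphNat {n m k : ℕ} {𝒞 : Finset (Finset (Fin n))}
    (h𝒞 : IsInitSeg 𝒞 (2 + k)) (hm : #(∂^[k] 𝒞) ≤ m) {s : Finset (Fin n)} (hs : s ∈ 𝒞) :
    s.map Fin.valEmbedding ∈ (colexGraphNat m).cliqueSet (2 + k) := by
  have hpairs : IsInitSeg (∂^[k] 𝒞) 2 := by simpa using isInitSeg_shadow_iterate h𝒞 k
  refine ⟨?_, by rw [card_map]; exact h𝒞.1 hs⟩
  rw [coe_map]
  rintro _ ⟨x, hx, rfl⟩ _ ⟨y, hy, rfl⟩ hxy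
  have hxys : {x, y} ∈ ∂^[k] 𝒞 := mem_shadow_iterate_iff_exists_mem_card_add.2
    ⟨s, hs, insert_subset hx (singleton_subset_iff.2 hy), by
      rw [card_pair (ne_of_apply_ne _ hxy)]; exact h𝒞.1 hs⟩
  exact ⟨hxy, by simpa using map_mem_colexPairs_of_isInitSeg hpairs hm hxys⟩

/- The colex-initial family with as many `(2 + k)`-sets as `G` has cliques has, by Kruskal–Katona,
at most as many pairs in its shadow as `G` has edges, so its members are cliques of the colex
graph. -/
theorem numCliques_two_add_le_colexGraphNat {n m : ℕ} (k : ℕ) (G : SimpleGraph (Fin n))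
    (hm : G.edgeSet.ncard ≤ m) :
    G.numCliques (2 + k) ≤ (colexGraphNat m).numCliques (2 + k) := by
  classical
  have hsized : (G.cliqueFinset (2 + k) : Set (Finset (Fin n))).Sized (2 + k) := fun s hs =>
    (G.mem_cliqueFinset_iff.1 hs).2
  obtain ⟨𝒞, h𝒞, hcard⟩ := exists_isInitSeg_card_eq (2 + k) hsized.card_le
  have hshadow : #(∂^[k] 𝒞) ≤ m := calc
    #(∂^[k] 𝒞) ≤ #(∂^[k] (G.cliqueFinset (2 + k))) := iterated_kk hsized hcard.le h𝒞
    _ ≤ #(G.cliqueFinset 2) := card_le_card (shadow_iterate_cliqueFinset_subset G 2 k)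
    _ ≤ G.edgeSet.ncard := card_cliqueFinset_two_le G
    _ ≤ m := hm
  have hfinite : ((colexGraphNat m).cliqueSet (2 + k)).Finite :=
    (finite_support_colexGraphNat m).toFinset.powerset.finite_toSet.subset fun s hs =>
      mem_powerset.2 fun x hx =>
        (Set.Finite.mem_toFinset _).2 (mem_support_of_mem_clique (by omega) hs hx)
  rw [numCliques, ← coe_cliqueFinset, Set.ncard_coe_finset, ← hcard,
    ← card_map (mapEmbedding Fin.valEmbedding).toEmbedding, ← Set.ncard_coe_finset]
  refine Set.ncard_le_ncard (fun S hS => ?_) hfinite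
  obtain ⟨s, hs, rfl⟩ := mem_map.1 (mem_coe.1 hS)
  exact map_mem_cliqueSet_colexGraphNat h𝒞 hshadow hs

theorem numCliques_le_colexGraphNat {V : Type*} [Finite V] {G : SimpleGraph V} {m t : ℕ}
    (ht : 2 ≤ t) (hm : G.edgeSet.ncard ≤ m) :
    G.numCliques t ≤ (colexGraphNat m).numCliques t := by
  obtain ⟨k, rfl⟩ := Nat.exists_eq_add_of_le ht
  have f := Iso.map (Finite.equivFin V) G
  rw [numCliques_congr f (by omega)]
  exact numCliques_two_add_le_colexGraphNat k _ ((Nat.card_congr f.mapEdgeSet).symm.trans_le hm)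

theorem numCliques_le_colexGraph {V : Type*} [Finite V] {G : SimpleGraph V} {m t : ℕ}
    (ht : 2 ≤ t) (hm : G.edgeSet.ncard ≤ m) :
    G.numCliques t ≤ (colexGraph m).numCliques t :=
  (numCliques_le_colexGraphNat ht hm).trans_eq (numCliques_colexGraph m (by omega)).symm

end KruskalKatona

section Obstructions

variable {V W : Type*} {G : SimpleGraph V} {H : SimpleGraph W}

theorem isCompletePlusVertex_of_iso (f : G ≃g H) {d : ℕ} (h : H.IsCompletePlusVertex d) :
    G.IsCompletePlusVertex d := by
  obtain ⟨w, hw, hadj⟩ := h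
  refine ⟨f.symm w, ?_, fun x y hx hy hxy => f.map_adj_iff.1 (hadj _ _ ?_ ?_ ?_)⟩
  · rw [← hw]
    exact Set.encard_congr ((f.symm.mapNeighborSet w).symm)
  · exact fun h => hx (f.eq_symm_apply.2 h)
  · exact fun h => hy (f.eq_symm_apply.2 h)
  · exact f.injective.ne hxy

theorem not_and_numCliques_eq_of_iso_colexGraph {n d t : ℕ} {P : Prop} (ht : t ≠ 1) (hd : 1 ≤ d)
    (hdn : d + 1 ≤ n) (hP : G.IsCompletePlusVertex d → ¬ P)
    (h : Nonempty (G ≃g colexGraph ((n - 1).choose 2 + d))) :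
    ¬ P ∧ G.numCliques t = (colexGraph ((n - 1).choose 2 + d)).numCliques t :=
  h.elim fun f => ⟨hP (isCompletePlusVertex_of_iso f (isCompletePlusVertex_colexGraph hd hdn)),
    numCliques_congr f ht⟩

theorem verts_subset_of_neighborSet_subset {K L : G.Subgraph} (hL : L.Preconnected) (hKL : K ≤ L)
    (hK : K.verts.Nonempty) (hnbhd : ∀ x ∈ K.verts, L.neighborSet x ⊆ K.neighborSet x) :
    L.verts ⊆ K.verts := by
  intro x hx
  by_contra hxK
  obtain ⟨y, hy⟩ := hK
  obtain ⟨p⟩ := hL.coe ⟨y, hKL.1 hy⟩ ⟨x, hx⟩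
  obtain ⟨e, -, hfst, hsnd⟩ := p.exists_boundary_dart (Subtype.val ⁻¹' K.verts) hy hxK
  exact hsnd (K.edge_vert (hnbhd _ hfst e.adj).symm)

theorem mem_support_of_isCycle_of_toSubgraph_le {a b : V} {c : G.Walk a a} {d : G.Walk b b}
    (hc : c.IsCycle) (hd : d.IsCycle) (hdc : d.toSubgraph ≤ c.toSubgraph) {x : V}
    (hx : x ∈ c.support) : x ∈ d.support := by
  rw [← Walk.mem_verts_toSubgraph] at hx ⊢
  refine verts_subset_of_neighborSet_subset c.toSubgraph_connected.preconnected hdc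
    ⟨b, d.start_mem_verts_toSubgraph⟩ (fun y hy => ?_) hx
  have hyd : y ∈ d.support := d.mem_verts_toSubgraph.1 hy
  have hyc : y ∈ c.support := c.mem_verts_toSubgraph.1 (hdc.1 hy)
  refine (Set.eq_of_subset_of_ncard_le (Subgraph.neighborSet_subset_of_subgraph hdc y) ?_
    c.finite_neighborSet_toSubgraph).ge
  rw [hc.ncard_neighborSet_toSubgraph_eq_two hyc, hd.ncard_neighborSet_toSubgraph_eq_two hyd]

theorem eq_or_eq_of_isCycle_adj_of_notMem_support {a u v w x : V} {c : G.Walk a a} (hc : c.IsCycle)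
    {p : G.Walk u v} (hp : p.IsPath) (hpc : p.toSubgraph ≤ c.toSubgraph) (hw : w ∉ p.support)
    (hx : x ∈ p.support) (hwx : c.toSubgraph.Adj w x) : x = u ∨ x = v := by
  obtain ⟨i, rfl, hi⟩ := p.mem_support_iff_exists_getVert.1 hx
  by_contra! hends
  have hpos : i ≠ 0 := by
    rintro rfl
    exact hends.1 p.getVert_zero
  have hlt : i < p.length := hi.lt_of_ne (by
    rintro rfl
    exact hends.2 p.getVert_length)
  have hnbhd : p.toSubgraph.neighborSet (p.getVert i) = c.toSubgraph.neighborSet (p.getVert i) := by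
    refine Set.eq_of_subset_of_ncard_le (Subgraph.neighborSet_subset_of_subgraph hpc _) ?_
      c.finite_neighborSet_toSubgraph
    rw [hp.ncard_neighborSet_toSubgraph_internal_eq_two hpos hlt,
      hc.ncard_neighborSet_toSubgraph_eq_two (Walk.mem_support_of_adj_toSubgraph hwx.symm)]
  have hpw : p.toSubgraph.Adj (p.getVert i) w := hnbhd.ge hwx.symm
  exact hw (Walk.mem_support_of_adj_toSubgraph hpw.symm)

/- The two cycle edges at `w` lead to the ends of the path, hence close it up to a cycle, which
must be all of `c`. -/
theorem adj_of_isCycle_of_isPath_through_neighborSet {a u v w z : V} {c : G.Walk a a}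
    (hc : c.IsCycle) {p : G.Walk u v} (hp : p.IsPath) (hpc : p.toSubgraph ≤ c.toSubgraph)
    (hpw : ∀ x, x ∈ p.support ↔ G.Adj w x) (hw : w ∈ c.support) (hz : z ∈ c.support)
    (hzw : z ≠ w) : G.Adj w z := by
  have hwp : w ∉ p.support := fun h => G.irrefl ((hpw w).1 h)
  have hcard := hc.ncard_neighborSet_toSubgraph_eq_two hw
  have hsub : c.toSubgraph.neighborSet w ⊆ {u, v} := fun x hx =>
    eq_or_eq_of_isCycle_adj_of_notMem_support hc hp hpc hwp ((hpw x).2 hx.adj_sub) hx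
  have huv : u ≠ v := by
    rintro rfl
    have := Set.ncard_le_ncard hsub
    rw [Set.pair_eq_singleton, Set.ncard_singleton] at this
    omega
  have hnbhd : c.toSubgraph.neighborSet w = {u, v} :=
    Set.eq_of_subset_of_ncard_le hsub (by rw [Set.ncard_pair huv, hcard])
  have hwu : c.toSubgraph.Adj w u := hnbhd.ge (.inl rfl)
  have hwv : c.toSubgraph.Adj w v := hnbhd.ge (.inr rfl)
  have hd : (Walk.cons hwu.adj_sub (p.concat hwv.adj_sub.symm)).IsCycle := by
    refine (Walk.cons_isCycle_iff _ _).2 ⟨hp.concat hwp _, fun hmem => ?_⟩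
    rw [Walk.edges_concat, List.concat_eq_append, List.mem_append, List.mem_singleton] at hmem
    rcases hmem with hmem | heq
    · exact hwp (p.fst_mem_support_of_mem_edges hmem)
    · rw [Sym2.eq_swap, Sym2.congr_left] at heq
      exact huv heq
  have hdc : (Walk.cons hwu.adj_sub (p.concat hwv.adj_sub.symm)).toSubgraph ≤ c.toSubgraph := by
    rw [Walk.concat_eq_append]
    simp only [Walk.toSubgraph, Walk.toSubgraph_append, sup_le_iff, singletonSubgraph_le_iff]
    exact ⟨subgraphOfAdj_le_of_adj _ hwu, hpc, subgraphOfAdj_le_of_adj _ hwv.symm, hwv.fst_mem⟩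
  have hzd := mem_support_of_isCycle_of_toSubgraph_le hc hd hdc hz
  simpa [Walk.support_concat, hzw, hpw] using hzd

theorem exists_ne_not_adj_of_encard_neighborSet [Fintype V] {w : V} {d : ℕ}
    (hw : (G.neighborSet w).encard = d) (hd : d + 2 ≤ Fintype.card V) :
    ∃ z, z ≠ w ∧ ¬ G.Adj w z := by
  by_contra! hall
  have huniv : (Set.univ : Set V) ⊆ insert w (G.neighborSet w) := fun z _ =>
    or_iff_not_imp_left.2 (hall z)
  have hle := (Set.encard_le_encard huniv).trans (Set.encard_insert_le _ _)
  rw [hw, Set.encard_univ, ENat.card_eq_coe_fintype_card] at hle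
  norm_cast at hle
  omega

theorem numCliques_of_isCompletePlusVertex_zero [Fintype V] (h : G.IsCompletePlusVertex 0)
    {t : ℕ} (ht : t ≠ 1) :
    G.numCliques t = (⊤ : SimpleGraph (Fin (Fintype.card V - 1))).numCliques t := by
  classical
  obtain ⟨w, hw, hadj⟩ := h
  have hcard : Fintype.card {x : V // x ≠ w} = Fintype.card V - 1 := by
    rw [Fintype.card_subtype_compl, Fintype.card_subtype_eq]
  let e : Fin (Fintype.card V - 1) ≃ {x : V // x ≠ w} := (Fintype.equivFinOfCardEq hcard).symm
  have hadj_iff {i j : Fin (Fintype.card V - 1)} : G.Adj (e i) (e j) ↔ i ≠ j :=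
    ⟨fun h hij => h.ne (by rw [hij]), fun hij =>
      hadj _ _ (e i).2 (e j).2 (Subtype.val_injective.ne (e.injective.ne hij))⟩
  let f : (⊤ : SimpleGraph (Fin (Fintype.card V - 1))) ↪g G :=
    ⟨e.toEmbedding.trans (Function.Embedding.subtype _), hadj_iff⟩
  refine (numCliques_eq_of_embedding f ?_ ht).symm
  rintro x hx
  obtain ⟨y, hxy⟩ := (mem_support _).1 hx
  have hxw : x ≠ w := by
    rintro rfl
    exact (Set.encard_eq_zero.1 hw).le hxy
  exact ⟨e.symm ⟨x, hxw⟩, congrArg Subtype.val (e.apply_symm_apply ⟨x, hxw⟩)⟩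

variable [DecidableEq V]

theorem preconnected_of_isTraceable (hG : G.IsTraceable) : G.Preconnected := by
  obtain ⟨u, v, p, hp⟩ := hG
  exact fun x y => (p.takeUntil x (hp.mem_support x)).reachable.symm.trans
    (p.takeUntil y (hp.mem_support y)).reachable

theorem not_isTraceable_of_isCompletePlusVertex [Nontrivial V] (h : G.IsCompletePlusVertex 0) :
    ¬ G.IsTraceable := by
  intro hG
  obtain ⟨w, hw, -⟩ := h
  obtain ⟨z, hz⟩ := (preconnected_of_isTraceable hG).exists_adj_of_nontrivial w
  exact (Set.encard_eq_zero.1 hw).le hz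

variable [Fintype V]

theorem not_isHamiltonian_of_encard_neighborSet_le_one {w : V}
    (hw : (G.neighborSet w).encard ≤ 1) (hV : Fintype.card V ≠ 1) : ¬ G.IsHamiltonian := by
  intro hG
  obtain ⟨a, c, hc⟩ := hG hV
  have hsub : (c.toSubgraph.neighborSet w).encard ≤ 1 :=
    (Set.encard_le_encard (c.toSubgraph.neighborSet_subset w)).trans hw
  rw [← (Set.toFinite (c.toSubgraph.neighborSet w)).cast_ncard_eq,
    hc.isCycle.ncard_neighborSet_toSubgraph_eq_two (hc.mem_support w)] at hsub
  norm_num at hsub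

theorem not_isHamiltonian_of_isCompletePlusVertex (h : G.IsCompletePlusVertex 1)
    (hV : Fintype.card V ≠ 1) : ¬ G.IsHamiltonian := by
  obtain ⟨w, hw, -⟩ := h
  exact not_isHamiltonian_of_encard_neighborSet_le_one hw.le hV

theorem not_isKHamiltonian_of_isCompletePlusVertex {k : ℕ} (h : G.IsCompletePlusVertex (k + 1))
    (hV : k + 3 ≤ Fintype.card V) : ¬ G.IsKHamiltonian k := by
  classical
  intro hG
  obtain ⟨w, hw, -⟩ := h
  have hdeg : #(G.neighborFinset w) = k + 1 := by
    rw [← coe_neighborFinset, Set.encard_coe_eq_coe_finsetCard] at hw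
    exact_mod_cast hw
  obtain ⟨s, hs, hsk⟩ := exists_subset_card_eq (show k ≤ #(G.neighborFinset w) by omega)
  have hws : w ∈ (↑(sᶜ) : Set V) := by
    rw [mem_coe, mem_compl]
    exact fun hmem => G.notMem_neighborFinset_self w (hs hmem)
  refine not_isHamiltonian_of_encard_neighborSet_le_one (w := ⟨w, hws⟩) ?_ ?_ (hG s hsk.le)
  · have hsub : Subtype.val '' ((G.induce (↑(sᶜ) : Set V)).neighborSet ⟨w, hws⟩) ⊆
        ↑(G.neighborFinset w \ s) := by
      rintro _ ⟨x, hx, rfl⟩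
      exact mem_sdiff.2 ⟨(G.mem_neighborFinset _ _).2 hx, mem_compl.1 x.2⟩
    rw [← Subtype.val_injective.encard_image]
    refine (Set.encard_le_encard hsub).trans_eq ?_
    rw [Set.encard_coe_eq_coe_finsetCard, card_sdiff_of_subset hs, hdeg, hsk,
      Nat.add_sub_cancel_left, Nat.cast_one]
  · rw [Fintype.card_of_finset' sᶜ fun _ => mem_coe.symm, card_compl]
    omega

theorem not_isPathHamiltonian_of_isCompletePlusVertex {k : ℕ} (h : G.IsCompletePlusVertex (k + 1))
    (hV : k + 3 ≤ Fintype.card V) : ¬ G.IsPathHamiltonian k := by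
  classical
  intro hG
  obtain ⟨w, hw, hadj⟩ := h
  obtain ⟨z, hz, hzw⟩ := exists_ne_not_adj_of_encard_neighborSet hw (by omega)
  have hlen : (G.neighborFinset w).toList.length = k + 1 := by
    rw [← coe_neighborFinset, Set.encard_coe_eq_coe_finsetCard] at hw
    rw [length_toList]
    exact_mod_cast hw
  have hmem (x : V) : x ∈ (G.neighborFinset w).toList ↔ G.Adj w x := by simp
  have hnodup := (G.neighborFinset w).nodup_toList
  have hchain : (G.neighborFinset w).toList.IsChain G.Adj :=
    (hnodup.imp_of_mem fun {x y} hx hy hxy =>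
      hadj x y ((hmem x).1 hx).ne' ((hmem y).1 hy).ne' hxy).isChain
  have hne : (G.neighborFinset w).toList ≠ [] := List.ne_nil_of_length_eq_add_one hlen
  have hp : (Walk.ofSupport _ hne hchain).IsPath := .mk' (by rwa [Walk.support_ofSupport])
  obtain ⟨a, c, hc, hpc⟩ := hG _ _ _ hp (by rw [Walk.length_ofSupport]; omega)
  exact hzw (adj_of_isCycle_of_isPath_through_neighborSet hc.isCycle hp hpc
    (fun x => by rw [Walk.support_ofSupport, hmem]) (hc.mem_support w) (hc.mem_support z) hz)

theorem exists_isHamiltonianCycle_of_adj (hG : G.IsHamiltonianConnected)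
    (hV : 3 ≤ Fintype.card V) {u v : V} (huv : G.Adj u v) :
    ∃ c : G.Walk u u, c.IsHamiltonianCycle ∧ c.toSubgraph.Adj u v := by
  obtain ⟨q, hq⟩ := hG v u huv.ne'
  have hlen : (Walk.cons huv q).length = Fintype.card V := by
    rw [Walk.length_cons, hq.length_eq]
    omega
  have hcycle : (Walk.cons huv q).IsCycle := Walk.isCycle_iff_isPath_tail_and_le_length.2
    ⟨by simpa using hq.isPath, hV.trans_eq hlen.symm⟩
  exact ⟨_, Walk.isHamiltonianCycle_iff_isCycle_and_length_eq.2 ⟨hcycle, hlen⟩,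
    by simp [Walk.toSubgraph]⟩

theorem isPathHamiltonian_one_of_isHamiltonianConnected (hG : G.IsHamiltonianConnected)
    (hV : 3 ≤ Fintype.card V) : G.IsPathHamiltonian 1 := by
  intro u v p _ hlen
  match p with
  | .nil =>
    have : Nontrivial V := Fintype.one_lt_card_iff_nontrivial.1 (by omega)
    obtain ⟨x, hx⟩ := exists_ne u
    obtain ⟨q, -⟩ := hG u x hx.symm
    have hadj := q.adj_snd (q.not_nil_of_ne hx.symm)
    obtain ⟨c, hc, -⟩ := exists_isHamiltonianCycle_of_adj hG hV hadj
    exact ⟨u, c, hc, by simp [Walk.toSubgraph]⟩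
  | .cons huv .nil =>
    obtain ⟨c, hc, hadj⟩ := exists_isHamiltonianCycle_of_adj hG hV huv
    exact ⟨u, c, hc, (Walk.toSubgraph_cons_nil_eq_subgraphOfAdj huv).trans_le
      (subgraphOfAdj_le_of_adj _ hadj)⟩
  | .cons _ (.cons _ _) => simp at hlen

theorem not_isHamiltonianConnected_of_isCompletePlusVertex (h : G.IsCompletePlusVertex 2)
    (hV : 4 ≤ Fintype.card V) : ¬ G.IsHamiltonianConnected := fun hG =>
  not_isPathHamiltonian_of_isCompletePlusVertex h hV
    (isPathHamiltonian_one_of_isHamiltonianConnected hG (by omega))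

end Obstructions

end HamiltonianExtremal

open HamiltonianExtremal

theorem mainTheorem12 {V : Type*} [Fintype V] [DecidableEq V] (G : SimpleGraph V)
    (n : ℕ) (hn : 1 ≤ n) (hV : Fintype.card V = n) (t : ℕ) (ht : 2 ≤ t) :
    -- traceability
    ((¬ G.IsTraceable → G.numCliques t ≤ (⊤ : SimpleGraph (Fin (n - 1))).numCliques t) ∧
      (G.IsCompletePlusVertex 0 →
        (2 ≤ n → ¬ G.IsTraceable) ∧
        G.numCliques t = (⊤ : SimpleGraph (Fin (n - 1))).numCliques t)) ∧
    -- Hamiltonicity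
    ((¬ G.IsHamiltonian →
        G.numCliques t ≤ (SimpleGraph.colexGraph ((n - 1).choose 2 + 1)).numCliques t) ∧
      (Nonempty (G ≃g SimpleGraph.colexGraph ((n - 1).choose 2 + 1)) →
        ¬ G.IsHamiltonian ∧
        G.numCliques t = (SimpleGraph.colexGraph ((n - 1).choose 2 + 1)).numCliques t) ∧
      (2 ≤ n →
        (SimpleGraph.colexGraphNat ((n - 1).choose 2 + 1)).support.encard = n ∧
        (SimpleGraph.colexGraph ((n - 1).choose 2 + 1)).IsCompletePlusVertex 1)) ∧
    -- Hamiltonian-connectedness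
    (4 ≤ n →
      (¬ G.IsHamiltonianConnected →
        G.numCliques t ≤ (SimpleGraph.colexGraph ((n - 1).choose 2 + 2)).numCliques t) ∧
      (Nonempty (G ≃g SimpleGraph.colexGraph ((n - 1).choose 2 + 2)) →
        ¬ G.IsHamiltonianConnected ∧
        G.numCliques t = (SimpleGraph.colexGraph ((n - 1).choose 2 + 2)).numCliques t) ∧
      (SimpleGraph.colexGraphNat ((n - 1).choose 2 + 2)).support.encard = n ∧
      (SimpleGraph.colexGraph ((n - 1).choose 2 + 2)).IsCompletePlusVertex 2) ∧
    -- `k`-path Hamiltonicity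
    (∀ k : ℕ, k + 3 ≤ n →
      (¬ G.IsPathHamiltonian k →
        G.numCliques t ≤ (SimpleGraph.colexGraph ((n - 1).choose 2 + k + 1)).numCliques t) ∧
      (Nonempty (G ≃g SimpleGraph.colexGraph ((n - 1).choose 2 + k + 1)) →
        ¬ G.IsPathHamiltonian k ∧
        G.numCliques t = (SimpleGraph.colexGraph ((n - 1).choose 2 + k + 1)).numCliques t)) ∧
    -- `k`-Hamiltonicity
    (∀ k : ℕ, k + 3 ≤ n →
      (¬ G.IsKHamiltonian k →
        G.numCliques t ≤ (SimpleGraph.colexGraph ((n - 1).choose 2 + k + 1)).numCliques t) ∧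
      (Nonempty (G ≃g SimpleGraph.colexGraph ((n - 1).choose 2 + k + 1)) →
        ¬ G.IsKHamiltonian k ∧
        G.numCliques t = (SimpleGraph.colexGraph ((n - 1).choose 2 + k + 1)).numCliques t)) ∧
    -- the colex graph of the last two parts
    (∀ k : ℕ, k + 3 ≤ n →
      (SimpleGraph.colexGraphNat ((n - 1).choose 2 + k + 1)).support.encard = n ∧
      (SimpleGraph.colexGraph ((n - 1).choose 2 + k + 1)).IsCompletePlusVertex (k + 1)) := by
  subst hV
  have ht1 : t ≠ 1 := by omega
  have hcolex {d : ℕ} (hd : 1 ≤ d) (hdn : d + 1 ≤ Fintype.card V) :=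
    And.intro (encard_support_colexGraphNat hd hdn) (isCompletePlusVertex_colexGraph hd hdn)
  refine ⟨⟨fun hG => ?_, fun h => ⟨fun h2 => ?_, numCliques_of_isCompletePlusVertex_zero h ht1⟩⟩,
    ⟨fun hG => numCliques_le_colexGraph ht (ncard_edgeSet_le_of_not_isHamiltonian hG),
      fun hf => ?_, hcolex le_rfl⟩,
    fun h4 => ⟨fun hG =>
        numCliques_le_colexGraph ht (ncard_edgeSet_le_of_not_isHamiltonianConnected hG),
      not_and_numCliques_eq_of_iso_colexGraph ht1 one_le_two (by omega)
        (not_isHamiltonianConnected_of_isCompletePlusVertex · h4), hcolex one_le_two (by omega)⟩,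
    fun k hk => ⟨fun hG =>
        numCliques_le_colexGraph ht (ncard_edgeSet_le_of_not_isPathHamiltonian hG),
      not_and_numCliques_eq_of_iso_colexGraph (d := k + 1) ht1 k.succ_pos (by omega)
        (not_isPathHamiltonian_of_isCompletePlusVertex · hk)⟩,
    fun k hk => ⟨fun hG => numCliques_le_colexGraph ht (ncard_edgeSet_le_of_not_isKHamiltonian hG),
      not_and_numCliques_eq_of_iso_colexGraph (d := k + 1) ht1 k.succ_pos (by omega)
        (not_isKHamiltonian_of_isCompletePlusVertex · hk)⟩,
    fun k hk => hcolex (d := k + 1) k.succ_pos (by omega)⟩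
  · rw [← numCliques_colexGraphNat_choose_two _ ht1]
    exact numCliques_le_colexGraphNat ht (ncard_edgeSet_le_of_not_isTraceable hG)
  · have : Nontrivial V := Fintype.one_lt_card_iff_nontrivial.1 h2
    exact not_isTraceable_of_isCompletePlusVertex h
  · have h2 : 1 < Fintype.card V := one_lt_card_of_iso_colexGraph (Nat.succ_pos _) hf.some
    exact not_and_numCliques_eq_of_iso_colexGraph ht1 le_rfl h2
      (not_isHamiltonian_of_isCompletePlusVertex · h2.ne') hf
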